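/- Let $X$ be a complex Banach space and let $A$, with domain $D(A)$, be the generator of a strongly continuous semigroup $\mathbf S=(S(t))_{t\ge 0}$ on $X$. Assume that $\mathbf S$ satisfies $\mathrm C$-maximal regularity, that is: there is $\tau>0$ such that for every $f\in \mathrm C([0,\tau],X)$ the function $(\mathbf S*f)(t):=\int_0^t S(t-s)f(s)\,\mathrm ds$ satisfies $(\mathbf S*f)(t)\in D(A)$ for almost every $t\in(0,\tau)$, and $A(\mathbf S*f)\in \mathrm C([0,\tau],X)$ (i.e. $A(\mathbf S*f)$ agrees almost everywhere on $(0,\tau)$ with a continuous function $[0,\tau]\to X$). Assume moreover that $A$ is unbounded. Then $X$ contains an isomorphic copy of $c_0$. More precisely, there exists a sequence $(z_n)_{n\in\mathbb N}$ in $X$ with the following properties: 1. the closed linear span $Z:=\overline{\operatorname{span}}\{z_n : n\in\mathbb N\}$ is isomorphic (linearly homeomorphic) to $c_0$; 2. $(z_n)_{n\in\mathbb N}$ is a Schauder basis of $Z$; 3. $0<\inf_n\|z_n\|\le\sup_n\|z_n\|<\infty$; 4. $\lim_{n\to\infty}R(\lambda,A)z_n=0$ for every $\lambda\in\rho(A)$,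 where $\rho(A)$ is the resolvent set of $A$ and $R(\lambda,A)=(\lambda-A)^{-1}$. -/

import Mathlib

open Filter Topology MeasureTheory Set
open scoped NNReal ZeroAtInfty

noncomputable section

/-- A strongly continuous semigroup `(S(t))_{t ≥ 0}` of bounded linear operators on `X`. -/
structure C0Semigroup (X : Type*) [NormedAddCommGroup X] [NormedSpace ℂ X] where
  /-- The operator `S(t)`. -/
  op : ℝ≥0 → X →L[ℂ] X
  op_zero : op 0 = ContinuousLinearMap.id ℂ X
  op_add : ∀ s t : ℝ≥0, op (s + t) = (op s).comp (op t)
  continuous_orbit : ∀ x : X, Continuous fun t : ℝ≥0 => op t x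

namespace C0Semigroup

variable {X : Type*} [NormedAddCommGroup X] [NormedSpace ℂ X] (S : C0Semigroup X)

/-- `S.HasGeneratorValue x y` says that `(S(t)x - x) / t → y` as `t → 0+`, that is,
`x` lies in the domain of the generator and the generator maps `x` to `y`. -/
def HasGeneratorValue (x y : X) : Prop :=
  Tendsto (fun t : ℝ≥0 => ((t : ℝ)⁻¹ : ℝ) • (S.op t x - x)) (𝓝[>] 0) (𝓝 y)

variable {S}

theorem HasGeneratorValue.unique {x y y' : X} (h : S.HasGeneratorValue x y)
    (h' : S.HasGeneratorValue x y') : y = y' :=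
  tendsto_nhds_unique h h'

theorem HasGeneratorValue.add {x x' y y' : X} (h : S.HasGeneratorValue x y)
    (h' : S.HasGeneratorValue x' y') : S.HasGeneratorValue (x + x') (y + y') := by
  refine (Tendsto.add h h').congr fun t => ?_
  rw [← smul_add, map_add]
  congr 1
  abel

theorem HasGeneratorValue.smul {x y : X} (c : ℂ) (h : S.HasGeneratorValue x y) :
    S.HasGeneratorValue (c • x) (c • y) := by
  refine (Tendsto.const_smul h c).congr fun t => ?_
  rw [map_smul, ← smul_sub, smul_comm]

theorem HasGeneratorValue.zero : S.HasGeneratorValue 0 0 := by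
  simp [HasGeneratorValue]

variable (S)

/-- The generator `A` of the semigroup, as a partially defined linear operator: its domain
`D(A)` is the set of all `x` for which `(S(t)x - x) / t` converges as `t → 0+`, and
`A x` is that limit. -/
def generator : X →ₗ.[ℂ] X where
  domain :=
    { carrier := {x | ∃ y, S.HasGeneratorValue x y}
      add_mem' := fun ⟨y, hy⟩ ⟨y', hy'⟩ => ⟨y + y', hy.add hy'⟩
      zero_mem' := ⟨0, HasGeneratorValue.zero⟩
      smul_mem' := fun c _ ⟨y, hy⟩ => ⟨c • y, hy.smul c⟩ }
  toFun :=
    { toFun := fun x => Classical.choose x.2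
      map_add' := fun x x' =>
        (Classical.choose_spec (x + x').2).unique
          ((Classical.choose_spec x.2).add (Classical.choose_spec x'.2))
      map_smul' := fun c x =>
        (Classical.choose_spec (c • x).2).unique ((Classical.choose_spec x.2).smul c) }

theorem mem_generator_domain {x : X} :
    x ∈ S.generator.domain ↔ ∃ y, S.HasGeneratorValue x y :=
  Iff.rfl

theorem generator_spec (x : S.generator.domain) :
    S.HasGeneratorValue (x : X) (S.generator x) :=
  Classical.choose_spec x.2

/-- The convolution `(S * f)(t) = ∫₀ᵗ S(t - s) f(s) ds`. It is only used for `t ≥ 0`, where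
`t - s ≥ 0` on the range of integration. -/
def conv (f : ℝ → X) (t : ℝ) : X :=
  ∫ s in (0 : ℝ)..t, S.op (t - s).toNNReal (f s)

/-- Maximal regularity with respect to continuous functions: for some `τ > 0` and all
`f ∈ C([0,τ], X)` one has `(S * f)(t) ∈ D(A)` for almost every `t ∈ (0,τ)`, and the almost
everywhere defined function `A(S * f)` is (almost everywhere equal to) an element `g` of
`C([0,τ], X)`. -/
def HasCMaximalRegularity : Prop :=
  ∃ τ : ℝ, 0 < τ ∧ ∀ f : ℝ → X, ContinuousOn f (Icc 0 τ) →
    ∃ g : ℝ → X, ContinuousOn g (Icc 0 τ) ∧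
      ∀ᵐ t ∂(volume.restrict (Ioo (0 : ℝ) τ)),
        ∃ h : S.conv f t ∈ S.generator.domain, S.generator ⟨S.conv f t, h⟩ = g t

end C0Semigroup

namespace UnboundedOperator

variable {X : Type*} [NormedAddCommGroup X] [NormedSpace ℂ X]

/-- `A` is bounded on its domain. A densely defined closed operator on a Banach space, such as
the generator of a strongly continuous semigroup, has this property if and only if it is an
everywhere defined bounded operator. -/
def IsBounded (A : X →ₗ.[ℂ] X) : Prop :=
  ∃ C : ℝ, ∀ x : A.domain, ‖A x‖ ≤ C * ‖(x : X)‖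

/-- The bounded operator `R` is a two-sided inverse of `μ - A : D(A) → X`. -/
def IsResolventAt (A : X →ₗ.[ℂ] X) (μ : ℂ) (R : X →L[ℂ] X) : Prop :=
  (∀ x : X, ∃ h : R x ∈ A.domain, μ • R x - A ⟨R x, h⟩ = x) ∧
    ∀ x : A.domain, R (μ • (x : X) - A x) = x

/-- The resolvent set `ρ(A)`. -/
def resolventSet (A : X →ₗ.[ℂ] X) : Set ℂ :=
  {μ | ∃ R : X →L[ℂ] X, IsResolventAt A μ R}

open scoped Classical in
/-- The resolvent operator `R(μ, A) = (μ - A)⁻¹` for `μ ∈ ρ(A)` (and `0` otherwise). -/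
def resolvent (A : X →ₗ.[ℂ] X) (μ : ℂ) : X →L[ℂ] X :=
  if h : μ ∈ resolventSet A then Classical.choose h else 0

theorem isResolventAt_resolvent {A : X →ₗ.[ℂ] X} {μ : ℂ} (h : μ ∈ resolventSet A) :
    IsResolventAt A μ (resolvent A μ) := by
  rw [resolvent, dif_pos h]
  exact Classical.choose_spec h

end UnboundedOperator

end

/-!
This is Baillon's theorem: `C`-maximal regularity of an unbounded generator forces a copy of `c₀`.

Since the generator is closed, maximal regularity gives a bounded operator `L f = A(S * f)(τ)` on
`C([0,τ], X)` (`HasCMaximalRegularity.exists_generator_convAt`). Let `f₀, f₁, …` be functions of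
norm at most `1` with disjoint supports, and put `zₙ = L fₙ`. Then
`‖∑ aₙ zₙ‖ ≤ ‖L‖ ‖∑ aₙ fₙ‖ ≤ ‖L‖ max |aₙ|`, which is the upper `c₀`-estimate. The unboundedness of
`A` enters through the failure of `S(t) → 1` in operator norm as `t → 0`
(`exists_op_sub_of_not_isBounded`): it allows the `fₙ` to be concentrated on shorter and shorter
intervals near `τ` while `‖zₙ‖ > 1/2` (`exists_concentrated`). Then `wₙ = (S * fₙ)(τ)` tends to `0`,
and `zₙ = A wₙ`, so that `R(μ,A) zₙ = μ R(μ,A) wₙ - wₙ → 0`.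

The lower `c₀`-estimate comes from functionals `φₘ` that are almost biorthogonal to the `zₙ`
(`exists_equiv_c0_of_almost_biorthogonal`); no general theory of basic sequences is needed. With
`Tₕ x = h⁻¹ ∫₀ʰ S(r)x dr`, take `φₘ = ψ ∘ Tₗ ∘ (1 - Tₖ)`, where `k` is so small that `(1 - Tₖ) zₙ`
is negligible for the earlier indices `n`, and `ψ` is a norming functional
(`exists_functional`). As `Tₗ A` is bounded, `φₘ(zₙ) = φₘ(A wₙ)` is negligible for all later indices
`n`, provided that `wₙ` is chosen small enough (`exists_selection_step`).
-/

noncomputable section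

namespace C0Semigroup

variable {X : Type*} [NormedAddCommGroup X] [NormedSpace ℂ X]

/-! ### Local boundedness, joint continuity and averaging operators -/

theorem op_comm (S : C0Semigroup X) (s t : ℝ≥0) (x : X) :
    S.op s (S.op t x) = S.op t (S.op s x) := by
  rw [← ContinuousLinearMap.comp_apply, ← S.op_add, add_comm, S.op_add,
    ContinuousLinearMap.comp_apply]

/-- By the uniform boundedness principle, a strongly continuous semigroup is bounded on compact
time intervals. -/
theorem exists_norm_op_le [CompleteSpace X] (S : C0Semigroup X) (T : ℝ≥0) :
    ∃ M : ℝ, 0 < M ∧ ∀ t ≤ T, ‖S.op t‖ ≤ M := by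
  obtain ⟨C, hC⟩ : ∃ C, ∀ t : Icc (0 : ℝ≥0) T, ‖S.op t‖ ≤ C := by
    refine banach_steinhaus fun x => ?_
    obtain ⟨C, hC⟩ := (isCompact_Icc (a := (0 : ℝ≥0)) (b := T)).exists_bound_of_continuousOn
      (S.continuous_orbit x).continuousOn
    exact ⟨C, fun t => hC t t.2⟩
  exact ⟨max C 1, by positivity, fun t ht => (hC ⟨t, zero_le, ht⟩).trans (le_max_left _ _)⟩

theorem continuous_uncurry_op [CompleteSpace X] (S : C0Semigroup X) :
    Continuous fun p : ℝ≥0 × X => S.op p.1 p.2 := by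
  rw [continuous_iff_continuousAt]
  rintro ⟨t, x⟩
  obtain ⟨M, -, hM⟩ := S.exists_norm_op_le (t + 1)
  have h1 : Tendsto (fun p : ℝ≥0 × X => S.op p.1 (p.2 - x)) (𝓝 (t, x)) (𝓝 0) := by
    have hlim : Tendsto (fun p : ℝ≥0 × X => M * ‖p.2 - x‖) (𝓝 (t, x)) (𝓝 0) := by
      have : Continuous fun p : ℝ≥0 × X => M * ‖p.2 - x‖ := by fun_prop
      simpa using this.tendsto (t, x)
    refine squeeze_zero_norm' ?_ hlim
    have hev : ∀ᶠ p : ℝ≥0 × X in 𝓝 (t, x), p.1 < t + 1 :=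
      (continuous_fst.tendsto (t, x)).eventually (gt_mem_nhds (lt_add_one t))
    filter_upwards [hev] with p hp
    exact (S.op p.1).le_of_opNorm_le (hM _ hp.le) _
  have h2 : Tendsto (fun p : ℝ≥0 × X => S.op p.1 x) (𝓝 (t, x)) (𝓝 (S.op t x)) :=
    ((S.continuous_orbit x).comp continuous_fst).tendsto (t, x)
  have h3 := h1.add h2
  simp only [map_sub, sub_add_cancel, zero_add] at h3
  exact h3

theorem continuous_op_apply [CompleteSpace X] (S : C0Semigroup X) {α : Type*} [TopologicalSpace α]
    {t : α → ℝ≥0} {x : α → X} (ht : Continuous t) (hx : Continuous x) :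
    Continuous fun a => S.op (t a) (x a) :=
  S.continuous_uncurry_op.comp (ht.prodMk hx)

theorem continuous_op_toNNReal (S : C0Semigroup X) (x : X) :
    Continuous fun r : ℝ => S.op r.toNNReal x :=
  (S.continuous_orbit x).comp continuous_real_toNNReal

/-- The bounded operator `x ↦ ∫₀ᵀ ρ(r) S(r)x dr` for a continuous weight `ρ`. -/
def weighted [CompleteSpace X] (S : C0Semigroup X) (ρ : C(ℝ, ℝ)) (T : ℝ≥0) : X →L[ℂ] X :=
  LinearMap.mkContinuousOfExistsBound
    { toFun := fun x => ∫ r in (0 : ℝ)..T, ρ r • S.op r.toNNReal x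
      map_add' := fun x y => by
        simp only [map_add, smul_add]
        exact intervalIntegral.integral_add
          ((ρ.continuous.smul (S.continuous_op_toNNReal x)).intervalIntegrable _ _)
          ((ρ.continuous.smul (S.continuous_op_toNNReal y)).intervalIntegrable _ _)
      map_smul' := fun c x => by
        simp only [map_smul, RingHom.id_apply]
        rw [← intervalIntegral.integral_smul]
        exact intervalIntegral.integral_congr fun r _ => smul_comm _ _ _ }
    (by
      obtain ⟨M, hM0, hM⟩ := S.exists_norm_op_le T
      obtain ⟨B, hB⟩ := (isCompact_Icc (a := (0 : ℝ)) (b := T)).exists_bound_of_continuousOn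
        ρ.continuous.continuousOn
      refine ⟨B * M * T, fun x => ?_⟩
      have := intervalIntegral.norm_integral_le_of_norm_le_const (a := (0 : ℝ)) (b := T)
        (f := fun r => ρ r • S.op r.toNNReal x) (C := B * (M * ‖x‖)) fun r hr => by
          rw [uIoc_of_le T.coe_nonneg] at hr
          rw [norm_smul]
          refine mul_le_mul (hB r ⟨hr.1.le, hr.2⟩) ((S.op _).le_of_opNorm_le (hM _ ?_) _)
            (norm_nonneg _) ((norm_nonneg _).trans (hB r ⟨hr.1.le, hr.2⟩))
          exact Real.toNNReal_le_iff_le_coe.2 hr.2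
      refine this.trans_eq ?_
      rw [sub_zero, abs_of_nonneg T.coe_nonneg]
      ring)

theorem weighted_apply [CompleteSpace X] (S : C0Semigroup X) (ρ : C(ℝ, ℝ)) (T : ℝ≥0) (x : X) :
    S.weighted ρ T x = ∫ r in (0 : ℝ)..T, ρ r • S.op r.toNNReal x :=
  rfl

/-- The bounded operator `x ↦ ∫₀ᵀ S(r)x dr`. -/
def primitive [CompleteSpace X] (S : C0Semigroup X) (T : ℝ≥0) : X →L[ℂ] X :=
  S.weighted 1 T

theorem primitive_apply [CompleteSpace X] (S : C0Semigroup X) (T : ℝ≥0) (x : X) :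
    S.primitive T x = ∫ r in (0 : ℝ)..T, S.op r.toNNReal x := by
  simp [primitive, weighted_apply]

theorem weighted_eq_of_support [CompleteSpace X] (S : C0Semigroup X) {ρ : C(ℝ, ℝ)} {T h : ℝ≥0}
    (hT : h ≤ T) (hsupp : ∀ r : ℝ, h ≤ r → ρ r = 0) (x : X) :
    S.weighted ρ T x = S.weighted ρ h x := by
  have hint : ∀ a b : ℝ, IntervalIntegrable (fun r => ρ r • S.op r.toNNReal x) volume a b :=
    fun a b => (ρ.continuous.smul (S.continuous_op_toNNReal x)).intervalIntegrable a b
  have hz : ∫ r in (h : ℝ)..T, ρ r • S.op r.toNNReal x = 0 := by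
    rw [intervalIntegral.integral_congr (g := fun _ => (0 : X)), intervalIntegral.integral_zero]
    intro r hr
    rw [uIcc_of_le (NNReal.coe_le_coe.2 hT)] at hr
    simp [hsupp r hr.1]
  rw [weighted_apply, weighted_apply,
    ← intervalIntegral.integral_add_adjacent_intervals (hint 0 h) (hint h T), hz, add_zero]

theorem norm_weighted_le [CompleteSpace X] (S : C0Semigroup X) {ρ : C(ℝ, ℝ)} {T : ℝ≥0} {M : ℝ}
    (hM : ∀ t ≤ T, ‖S.op t‖ ≤ M) (hρ : ∀ r, |ρ r| ≤ 1) (x : X) :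
    ‖S.weighted ρ T x‖ ≤ M * ‖x‖ * T := by
  rw [weighted_apply]
  have := intervalIntegral.norm_integral_le_of_norm_le_const (a := (0 : ℝ)) (b := T)
    (f := fun r => ρ r • S.op r.toNNReal x) (C := M * ‖x‖) fun r hr => by
      rw [uIoc_of_le T.coe_nonneg] at hr
      rw [norm_smul]
      refine (mul_le_of_le_one_left (norm_nonneg _) (hρ r)).trans ?_
      exact (S.op _).le_of_opNorm_le (hM _ (Real.toNNReal_le_iff_le_coe.2 hr.2)) _
  simpa using this

theorem norm_primitive_le [CompleteSpace X] (S : C0Semigroup X) {T : ℝ≥0} {M : ℝ}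
    (hM : ∀ t ≤ T, ‖S.op t‖ ≤ M) (x : X) : ‖S.primitive T x‖ ≤ M * ‖x‖ * T :=
  S.norm_weighted_le hM (fun r => by simp) x

theorem op_weighted [CompleteSpace X] (S : C0Semigroup X) (ρ : C(ℝ, ℝ)) (T t : ℝ≥0) (x : X) :
    S.op t (S.weighted ρ T x) = S.weighted ρ T (S.op t x) := by
  have hint : IntervalIntegrable (fun r => ρ r • S.op r.toNNReal x) volume 0 T :=
    (ρ.continuous.smul (S.continuous_op_toNNReal x)).intervalIntegrable _ _
  rw [weighted_apply, weighted_apply, ← ContinuousLinearMap.intervalIntegral_comp_comm _ hint]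
  refine intervalIntegral.integral_congr fun r _ => ?_
  rw [ContinuousLinearMap.map_smul_of_tower, S.op_comm]

/-- `S(t) ∫₀ʰ S(r)x dr = ∫₀ᵗ⁺ʰ S(r)x dr - ∫₀ᵗ S(r)x dr`. -/
theorem op_primitive [CompleteSpace X] (S : C0Semigroup X) (t h : ℝ≥0) (x : X) :
    S.op t (S.primitive h x) = S.primitive (t + h) x - S.primitive t x := by
  simp only [primitive_apply]
  rw [intervalIntegral.integral_interval_sub_left
    ((S.continuous_op_toNNReal x).intervalIntegrable _ _)
    ((S.continuous_op_toNNReal x).intervalIntegrable _ _),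
    ← ContinuousLinearMap.intervalIntegral_comp_comm _
    ((S.continuous_op_toNNReal x).intervalIntegrable _ _)]
  have := intervalIntegral.integral_comp_add_left (a := (0 : ℝ)) (b := h)
    (fun r => S.op r.toNNReal x) (t : ℝ)
  rw [add_zero] at this
  rw [NNReal.coe_add, ← this]
  refine intervalIntegral.integral_congr fun r hr => ?_
  rw [uIcc_of_le h.coe_nonneg] at hr
  rw [Real.toNNReal_add t.coe_nonneg hr.1, Real.toNNReal_coe, S.op_add,
    ContinuousLinearMap.comp_apply]

/-! ### The generator -/

theorem tendsto_inv_smul_primitive [CompleteSpace X] (S : C0Semigroup X) (x : X) :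
    Tendsto (fun t : ℝ≥0 => ((t : ℝ)⁻¹ : ℝ) • S.primitive t x) (𝓝[>] 0) (𝓝 x) := by
  have hd : HasDerivAt (fun t : ℝ => ∫ r in (0 : ℝ)..t, S.op r.toNNReal x)
      (S.op (0 : ℝ).toNNReal x) 0 :=
    ((S.continuous_op_toNNReal x).integral_hasStrictDerivAt 0 0).hasDerivAt
  have h0 : S.op (0 : ℝ).toNNReal x = x := by simp [S.op_zero]
  rw [h0, hasDerivAt_iff_tendsto_slope_zero] at hd
  have hc : Tendsto (fun t : ℝ≥0 => (t : ℝ)) (𝓝[>] 0) (𝓝[≠] 0) := by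
    refine tendsto_nhdsWithin_iff.2 ⟨?_, ?_⟩
    · exact (NNReal.continuous_coe.tendsto' 0 0 rfl).mono_left nhdsWithin_le_nhds
    · filter_upwards [self_mem_nhdsWithin] with t ht
      exact (NNReal.coe_pos.2 ht).ne'
  refine (hd.comp hc).congr fun t => ?_
  simp [primitive_apply]

theorem HasGeneratorValue.map {S : C0Semigroup X} {x y : X} (h : S.HasGeneratorValue x y)
    (W : X →L[ℂ] X) (hW : ∀ t x, S.op t (W x) = W (S.op t x)) :
    S.HasGeneratorValue (W x) (W y) := by
  refine ((W.continuous.tendsto y).comp h).congr fun t => ?_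
  simp [hW]

theorem HasGeneratorValue.weighted [CompleteSpace X] {S : C0Semigroup X} {x y : X}
    (h : S.HasGeneratorValue x y) (ρ : C(ℝ, ℝ)) (T : ℝ≥0) :
    S.HasGeneratorValue (S.weighted ρ T x) (S.weighted ρ T y) :=
  h.map _ fun _ _ => S.op_weighted _ _ _ _

theorem HasGeneratorValue.op_sub_eq_primitive [CompleteSpace X] {S : C0Semigroup X} {x y : X}
    (h : S.HasGeneratorValue x y) (t : ℝ≥0) : S.op t x - x = S.primitive t y := by
  have hd : ∀ r ∈ Ioo (min 0 (t : ℝ)) (max 0 (t : ℝ)),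
      HasDerivWithinAt (fun r : ℝ => S.op r.toNNReal x) (S.op r.toNNReal y) (Ioi r) r := by
    intro r hr
    rw [min_eq_left t.coe_nonneg, max_eq_right t.coe_nonneg] at hr
    rw [hasDerivWithinAt_iff_tendsto_slope' (by simp)]
    have hc : Tendsto (fun s : ℝ => (s - r).toNNReal) (𝓝[>] r) (𝓝[>] 0) := by
      refine tendsto_nhdsWithin_iff.2 ⟨?_, ?_⟩
      · refine Tendsto.mono_left ?_ nhdsWithin_le_nhds
        have : Continuous fun s : ℝ => (s - r).toNNReal := by fun_prop
        simpa using this.tendsto r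
      · filter_upwards [self_mem_nhdsWithin] with s hs
        simpa using hs
    refine ((((S.op r.toNNReal).continuous.tendsto y).comp h).comp hc).congr' ?_
    filter_upwards [self_mem_nhdsWithin] with s hs
    have hs' : r < s := hs
    have hsr : s.toNNReal = r.toNNReal + (s - r).toNNReal := by
      rw [← Real.toNNReal_add hr.1.le (sub_nonneg.2 hs'.le), add_sub_cancel]
    simp only [Function.comp_apply, slope_def_module, ContinuousLinearMap.map_smul_of_tower]
    rw [hsr, S.op_add, Real.coe_toNNReal _ (sub_nonneg.2 hs'.le)]
    simp
  rw [primitive_apply, intervalIntegral.integral_eq_sub_of_hasDeriv_right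
    (S.continuous_op_toNNReal x).continuousOn hd
    ((S.continuous_op_toNNReal y).intervalIntegrable _ _)]
  simp [S.op_zero]

/-- The generator, described without a limit. Closedness of the generator is immediate from this
description, because both sides depend continuously on `(x, y)`. -/
theorem hasGeneratorValue_iff_op_sub_eq_primitive [CompleteSpace X] {S : C0Semigroup X} {x y : X} :
    S.HasGeneratorValue x y ↔ ∀ t, S.op t x - x = S.primitive t y := by
  refine ⟨fun h t => h.op_sub_eq_primitive t, fun h => ?_⟩
  refine (S.tendsto_inv_smul_primitive y).congr fun t => ?_
  rw [h]

theorem HasGeneratorValue.of_tendsto [CompleteSpace X] {S : C0Semigroup X} {ι : Type*}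
    {l : Filter ι} [l.NeBot] {u v : ι → X} {x y : X} (hu : Tendsto u l (𝓝 x))
    (hv : Tendsto v l (𝓝 y)) (h : ∀ᶠ i in l, S.HasGeneratorValue (u i) (v i)) :
    S.HasGeneratorValue x y := by
  rw [hasGeneratorValue_iff_op_sub_eq_primitive]
  intro t
  refine tendsto_nhds_unique ((((S.op t).continuous.tendsto x).comp hu).sub hu)
    ((((S.primitive t).continuous.tendsto y).comp hv).congr' ?_)
  filter_upwards [h] with i hi
  exact (hi.op_sub_eq_primitive t).symm

theorem hasGeneratorValue_primitive [CompleteSpace X] (S : C0Semigroup X) (h : ℝ≥0) (x : X) :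
    S.HasGeneratorValue (S.primitive h x) (S.op h x - x) := by
  rw [hasGeneratorValue_iff_op_sub_eq_primitive]
  intro t
  have hcomm : S.primitive t (S.op h x) = S.op h (S.primitive t x) :=
    (S.op_weighted 1 t h x).symm
  rw [map_sub, hcomm, S.op_primitive, S.op_primitive, add_comm t h]
  abel

/-- If `‖S(r) - 1‖ ≤ 1/2` for small `r`, then the average `Tₜ` of `S` over `[0,t]` satisfies
`‖Tₜ - 1‖ ≤ 1/2`, while `Tₜ A` is bounded; hence `A` is bounded. So for unbounded `A` the
operators `S(t)` stay away from the identity, and by density this is witnessed in `D(A)`. -/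
theorem exists_op_sub_of_not_isBounded [CompleteSpace X] (S : C0Semigroup X)
    (hA : ¬ UnboundedOperator.IsBounded S.generator) {ε : ℝ≥0} (hε : 0 < ε) :
    ∃ t : ℝ≥0, 0 < t ∧ t ≤ ε ∧ ∃ x y : X, S.HasGeneratorValue x y ∧ ‖x‖ ≤ 1 ∧
      1 / 2 < ‖S.op t x - x‖ := by
  by_contra! hcon
  -- By homogeneity the bound holds on `D(A)`; it is needed on all of `X`, since it gets applied to
  -- `A x`. Density of `D(A)` extends it.
  have hball : ∀ t : ℝ≥0, t ≤ ε → ∀ x y : X, S.HasGeneratorValue x y →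
      ‖S.op t x - x‖ ≤ 1 / 2 * ‖x‖ := by
    intro t ht x y hxy
    rcases eq_or_ne x 0 with rfl | hx
    · simp
    rcases eq_zero_or_pos t with rfl | ht0
    · simp [S.op_zero]
    have hx' : (‖x‖ : ℂ) ≠ 0 := by simpa using hx
    have := hcon t ht0 ht (((‖x‖ : ℂ)⁻¹) • x) _ (hxy.smul _) (by
      rw [norm_smul, norm_inv, Complex.norm_real, norm_norm,
        inv_mul_cancel₀ (norm_ne_zero_iff.2 hx)])
    rw [map_smul, ← smul_sub, norm_smul, norm_inv, Complex.norm_real, norm_norm,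
      inv_mul_le_iff₀ (norm_pos_iff.2 hx)] at this
    linarith
  have hall : ∀ t : ℝ≥0, t ≤ ε → ∀ x : X, ‖S.op t x - x‖ ≤ 1 / 2 * ‖x‖ := by
    intro t ht x
    have hlim := S.tendsto_inv_smul_primitive x
    refine le_of_tendsto_of_tendsto ((((S.op t).continuous.tendsto x).comp hlim).sub hlim).norm
      (hlim.norm.const_mul (1 / 2)) (Eventually.of_forall fun h => ?_)
    have hg := (S.hasGeneratorValue_primitive h x).smul (((h : ℝ)⁻¹ : ℝ) : ℂ)
    rw [Complex.coe_smul] at hg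
    exact hball t ht _ _ hg
  have hε' : (0 : ℝ) < ε := NNReal.coe_pos.2 hε
  refine hA ⟨(ε : ℝ)⁻¹, fun x => ?_⟩
  set y := S.generator x with hy
  have hprim : ‖S.primitive ε y‖ ≤ 1 / 2 * ‖(x : X)‖ := by
    rw [← (S.generator_spec x).op_sub_eq_primitive]
    exact hall ε le_rfl x
  have hdiff : ‖S.primitive ε y - (ε : ℝ) • y‖ ≤ 1 / 2 * ‖y‖ * ε := by
    have h1 : S.primitive ε y - (ε : ℝ) • y
        = ∫ r in (0 : ℝ)..ε, (S.op r.toNNReal y - y) := by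
      rw [intervalIntegral.integral_sub ((S.continuous_op_toNNReal y).intervalIntegrable _ _)
        intervalIntegrable_const, intervalIntegral.integral_const, sub_zero, primitive_apply]
    rw [h1]
    have := intervalIntegral.norm_integral_le_of_norm_le_const (a := (0 : ℝ)) (b := ε)
      (f := fun r => S.op r.toNNReal y - y) (C := 1 / 2 * ‖y‖) fun r hr => by
        rw [uIoc_of_le ε.coe_nonneg] at hr
        exact hall _ (Real.toNNReal_le_iff_le_coe.2 hr.2) y
    simpa using this
  have htri : ‖(ε : ℝ) • y‖ ≤ ‖S.primitive ε y‖ + ‖S.primitive ε y - (ε : ℝ) • y‖ := by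
    have := norm_sub_le (S.primitive ε y) (S.primitive ε y - (ε : ℝ) • y)
    rwa [sub_sub_cancel] at this
  rw [norm_smul, Real.norm_of_nonneg hε'.le] at htri
  rw [inv_mul_eq_div, le_div_iff₀ hε']
  linarith

end C0Semigroup

namespace C0Semigroup

variable {X : Type*} [NormedAddCommGroup X] [NormedSpace ℂ X]

/-! ### The operator `f ↦ A(S * f)(τ)` -/

theorem continuous_conv [CompleteSpace X] (S : C0Semigroup X) {f : ℝ → X} (hf : Continuous f) :
    Continuous fun t => S.conv f t := by
  refine intervalIntegral.continuous_parametric_intervalIntegral_of_continuous (μ := volume)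
    (f := fun t s : ℝ => S.op (t - s).toNNReal (f s)) ?_ continuous_id
  refine S.continuous_op_apply ?_ (hf.comp continuous_snd)
  fun_prop

/-- Evaluation of the convolution at the right end point, `f ↦ (S * f)(τ)`, as a bounded operator
on `C([0,τ], X)`. -/
def convAt [CompleteSpace X] (S : C0Semigroup X) (τ : ℝ≥0) : C(Icc (0 : ℝ) τ, X) →L[ℂ] X :=
  LinearMap.mkContinuousOfExistsBound
    { toFun := fun f => S.conv (IccExtend τ.coe_nonneg f) τ
      map_add' := fun f g => by
        simp only [conv]
        rw [← intervalIntegral.integral_add]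
        · refine intervalIntegral.integral_congr fun s _ => ?_
          simp [IccExtend]
        · exact (S.continuous_op_apply (by fun_prop) f.continuous.Icc_extend').intervalIntegrable _ _
        · exact (S.continuous_op_apply (by fun_prop) g.continuous.Icc_extend').intervalIntegrable _ _
      map_smul' := fun c f => by
        simp only [conv, RingHom.id_apply]
        rw [← intervalIntegral.integral_smul]
        refine intervalIntegral.integral_congr fun s _ => ?_
        simp [IccExtend] }
    (by
      obtain ⟨M, hM0, hM⟩ := S.exists_norm_op_le τ
      refine ⟨M * τ, fun f => ?_⟩
      have := intervalIntegral.norm_integral_le_of_norm_le_const (a := (0 : ℝ)) (b := τ)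
        (f := fun s => S.op ((τ : ℝ) - s).toNNReal (IccExtend τ.coe_nonneg f s))
        (C := M * ‖f‖) fun s hs => by
          rw [uIoc_of_le τ.coe_nonneg] at hs
          refine (S.op _).le_of_opNorm_le_of_le (hM _ ?_) (f.norm_coe_le_norm _)
          rw [Real.toNNReal_le_iff_le_coe]
          linarith [hs.1]
      refine this.trans_eq ?_
      rw [sub_zero, abs_of_nonneg τ.coe_nonneg]
      ring)

theorem convAt_apply [CompleteSpace X] (S : C0Semigroup X) (τ : ℝ≥0) (f : C(Icc (0 : ℝ) τ, X)) :
    S.convAt τ f = S.conv (IccExtend τ.coe_nonneg f) τ :=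
  rfl

theorem frequently_nhdsLT_of_ae_restrict {τ : ℝ} (hτ : 0 < τ) {p : ℝ → Prop}
    (hp : ∀ᵐ t ∂(volume.restrict (Ioo (0 : ℝ) τ)), p t) : ∃ᶠ t in 𝓝[<] τ, p t := by
  intro hev
  obtain ⟨c, hc, hsub⟩ := (mem_nhdsLT_iff_exists_Ioo_subset' hτ).1 hev
  rw [ae_restrict_iff' measurableSet_Ioo, ae_iff] at hp
  have h0 : volume (Ioo (max c 0) τ) = 0 := by
    refine measure_mono_null (fun t ht => ?_) hp
    rw [mem_ofPred_eq, Classical.not_imp]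
    exact ⟨⟨(le_max_right _ _).trans_lt ht.1, ht.2⟩,
      hsub ⟨(le_max_left _ _).trans_lt ht.1, ht.2⟩⟩
  rw [Real.volume_Ioo, ENNReal.ofReal_eq_zero, sub_nonpos] at h0
  exact absurd (max_lt hc hτ) (not_lt.2 h0)

/-- Closedness of the generator and continuity of `S * f` turn the almost everywhere statement of
maximal regularity into one at the end point `τ`. -/
theorem exists_hasGeneratorValue_convAt [CompleteSpace X] {S : C0Semigroup X} {τ : ℝ≥0}
    (hτ : 0 < τ) {f : C(Icc (0 : ℝ) τ, X)} {g : ℝ → X} (hg : ContinuousOn g (Icc 0 τ))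
    (h : ∀ᵐ t ∂(volume.restrict (Ioo (0 : ℝ) τ)),
      S.HasGeneratorValue (S.conv (IccExtend τ.coe_nonneg f) t) (g t)) :
    S.HasGeneratorValue (S.convAt τ f) (g τ) := by
  have hτ' : (0 : ℝ) < τ := NNReal.coe_pos.2 hτ
  have hfreq := frequently_nhdsLT_of_ae_restrict hτ' h
  have : (𝓝[<] (τ : ℝ) ⊓ 𝓟 {t | S.HasGeneratorValue (S.conv (IccExtend τ.coe_nonneg f) t)
    (g t)}).NeBot := frequently_mem_iff_neBot.1 hfreq
  refine HasGeneratorValue.of_tendsto (l := 𝓝[<] (τ : ℝ) ⊓ 𝓟 {t | S.HasGeneratorValue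
    (S.conv (IccExtend τ.coe_nonneg f) t) (g t)}) (u := S.conv (IccExtend τ.coe_nonneg f))
    (v := g) ?_ ?_ ?_
  · exact ((S.continuous_conv f.continuous.Icc_extend').tendsto _).mono_left
      (inf_le_left.trans nhdsWithin_le_nhds)
  · refine Tendsto.mono_left ?_ inf_le_left
    rw [← nhdsWithin_Ioo_eq_nhdsLT hτ']
    exact (hg τ ⟨hτ'.le, le_rfl⟩).mono Ioo_subset_Icc_self
  · exact mem_inf_of_right (mem_principal_self _)

/-- Maximal regularity makes `f ↦ A(S * f)(τ)` an everywhere defined operator on `C([0,τ], X)`,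
which is bounded by the closed graph theorem. -/
theorem HasCMaximalRegularity.exists_generator_convAt [CompleteSpace X] {S : C0Semigroup X}
    (hS : S.HasCMaximalRegularity) :
    ∃ τ : ℝ≥0, 0 < τ ∧ ∃ L : C(Icc (0 : ℝ) τ, X) →L[ℂ] X,
      ∀ f, S.HasGeneratorValue (S.convAt τ f) (L f) := by
  obtain ⟨τ, hτ, h⟩ := hS
  lift τ to ℝ≥0 using hτ.le
  have hτ0 : 0 < τ := NNReal.coe_pos.1 hτ
  refine ⟨τ, hτ0, ?_⟩
  have hex : ∀ f : C(Icc (0 : ℝ) τ, X), ∃ y, S.HasGeneratorValue (S.convAt τ f) y := by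
    intro f
    obtain ⟨g, hg, hae⟩ := h (IccExtend τ.coe_nonneg f) f.continuous.Icc_extend'.continuousOn
    refine ⟨g τ, exists_hasGeneratorValue_convAt hτ0 hg ?_⟩
    filter_upwards [hae] with t ht
    obtain ⟨hmem, heq⟩ := ht
    rw [← heq]
    exact S.generator_spec ⟨_, hmem⟩
  choose A hA using hex
  let A' : C(Icc (0 : ℝ) τ, X) →ₗ[ℂ] X :=
    { toFun := A
      map_add' := fun f g => (hA (f + g)).unique (by
        rw [map_add]
        exact (hA f).add (hA g))
      map_smul' := fun c f => (hA (c • f)).unique (by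
        rw [map_smul]
        exact (hA f).smul c) }
  refine ⟨ContinuousLinearMap.ofSeqClosedGraph (g := A') fun u f y hu hy => ?_, hA⟩
  refine (HasGeneratorValue.of_tendsto (((S.convAt τ).continuous.tendsto f).comp hu) hy
    (Eventually.of_forall fun n => ?_)).unique (hA f)
  exact hA (u n)

/-! ### Functions concentrated near the end point on which `A(S * ·)(τ)` is large -/

/-- Continuous weights with support in `(0,t)` increasing to the indicator function of `(0,t)`. -/
def bump (t : ℝ) (n : ℕ) : C(ℝ, ℝ) :=
  ⟨fun r => max 0 (min 1 ((n + 1) * min r (t - r) - 1)), by fun_prop⟩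

theorem bump_apply (t : ℝ) (n : ℕ) (r : ℝ) :
    bump t n r = max 0 (min 1 ((n + 1) * min r (t - r) - 1)) :=
  rfl

theorem abs_bump_le (t : ℝ) (n : ℕ) (r : ℝ) : |bump t n r| ≤ 1 := by
  rw [bump_apply, abs_of_nonneg (le_max_left _ _)]
  exact max_le zero_le_one (min_le_left _ _)

theorem bump_eq_zero_of_le {t : ℝ} {n : ℕ} {r : ℝ} (hr : r ≤ 1 / ((n : ℝ) + 1)) :
    bump t n r = 0 := by
  have hn : (0 : ℝ) < n + 1 := by positivity
  rw [bump_apply, max_eq_left]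
  refine (min_le_right _ _).trans (sub_nonpos.2 ?_)
  rw [le_div_iff₀ hn] at hr
  calc ((n : ℝ) + 1) * min r (t - r) ≤ (n + 1) * r := by gcongr; exact min_le_left _ _
    _ ≤ 1 := by linarith

theorem bump_eq_zero_of_ge {t : ℝ} {n : ℕ} {r : ℝ} (hr : t ≤ r) : bump t n r = 0 := by
  have hn : (0 : ℝ) < n + 1 := by positivity
  rw [bump_apply, max_eq_left]
  refine (min_le_right _ _).trans (sub_nonpos.2 ?_)
  have : ((n : ℝ) + 1) * min r (t - r) ≤ 0 :=
    mul_nonpos_of_nonneg_of_nonpos hn.le ((min_le_right _ _).trans (by linarith))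
  linarith

theorem tendsto_bump {t r : ℝ} (h0 : 0 < r) (ht : r < t) :
    Tendsto (fun n => bump t n r) atTop (𝓝 1) := by
  have hm : 0 < min r (t - r) := lt_min h0 (sub_pos.2 ht)
  obtain ⟨N, hN⟩ := exists_nat_gt (2 / min r (t - r))
  rw [div_lt_iff₀ hm] at hN
  refine tendsto_const_nhds.congr' ?_
  filter_upwards [eventually_ge_atTop N] with n hn
  have hn' : (N : ℝ) ≤ n := Nat.cast_le.2 hn
  have : (1 : ℝ) ≤ (n + 1) * min r (t - r) - 1 := by nlinarith
  rw [bump_apply, min_eq_left this, max_eq_right zero_le_one]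

theorem tendsto_weighted_bump [CompleteSpace X] (S : C0Semigroup X) (t : ℝ≥0) (y : X) :
    Tendsto (fun n => S.weighted (bump t n) t y) atTop (𝓝 (S.primitive t y)) := by
  simp only [weighted_apply, primitive_apply]
  refine intervalIntegral.tendsto_integral_filter_of_dominated_convergence
    (fun r => ‖S.op r.toNNReal y‖) ?_ ?_ ?_ ?_
  · exact Eventually.of_forall fun n =>
      ((bump t n).continuous.smul (S.continuous_op_toNNReal y)).aestronglyMeasurable
  · refine Eventually.of_forall fun n => Eventually.of_forall fun r _ => ?_
    rw [norm_smul]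
    exact mul_le_of_le_one_left (norm_nonneg _) (abs_bump_le _ _ _)
  · exact (S.continuous_op_toNNReal y).norm.intervalIntegrable _ _
  · filter_upwards [Measure.ae_ne volume (t : ℝ)] with r hrt hr
    rw [uIoc_of_le t.coe_nonneg] at hr
    simpa using (tendsto_bump hr.1 (lt_of_le_of_ne hr.2 hrt)).smul_const (S.op r.toNNReal y)

/-- The function `s ↦ ρ(τ - s) x` in `C([0,τ], X)`. -/
def reflectedSMul (τ : ℝ≥0) (ρ : C(ℝ, ℝ)) (x : X) : C(Icc (0 : ℝ) τ, X) :=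
  ⟨fun s => ρ (τ - s) • x, by fun_prop⟩

theorem reflectedSMul_apply (τ : ℝ≥0) (ρ : C(ℝ, ℝ)) (x : X) (s : Icc (0 : ℝ) τ) :
    reflectedSMul τ ρ x s = ρ (τ - s) • x :=
  rfl

theorem convAt_reflectedSMul [CompleteSpace X] (S : C0Semigroup X) (τ : ℝ≥0) (ρ : C(ℝ, ℝ))
    (x : X) : S.convAt τ (reflectedSMul τ ρ x) = S.weighted ρ τ x := by
  have := intervalIntegral.integral_comp_sub_left (a := (0 : ℝ)) (b := τ)
    (fun r => ρ r • S.op r.toNNReal x) (τ : ℝ)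
  rw [sub_self, sub_zero] at this
  rw [weighted_apply, ← this, convAt_apply, conv]
  refine intervalIntegral.integral_congr fun s hs => ?_
  rw [uIcc_of_le τ.coe_nonneg] at hs
  rw [IccExtend_of_mem _ _ hs, reflectedSMul_apply, ContinuousLinearMap.map_smul_of_tower]

/-- For `x ∈ D(A)` one has `A(S * f)(τ) = ∫ ρ(r) S(r)Ax dr` when `f(s) = ρ(τ - s) x`. As `ρ`
approaches the indicator function of `(0,t)`, this tends to `S(t)x - x`. -/
theorem exists_concentrated [CompleteSpace X] {S : C0Semigroup X}
    (hA : ¬ UnboundedOperator.IsBounded S.generator) {τ : ℝ≥0} {L : C(Icc (0 : ℝ) τ, X) →L[ℂ] X}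
    (hL : ∀ f, S.HasGeneratorValue (S.convAt τ f) (L f)) {M : ℝ} (hM0 : 0 ≤ M)
    (hM : ∀ t ≤ τ, ‖S.op t‖ ≤ M) {ε : ℝ≥0} (hε : 0 < ε) (hετ : ε ≤ τ) :
    ∃ (f : C(Icc (0 : ℝ) τ, X)) (a : ℝ≥0), 0 < a ∧ ‖f‖ ≤ 1 ∧
      (∀ s : Icc (0 : ℝ) τ, τ - (s : ℝ) ≤ a → f s = 0) ∧
      (∀ s : Icc (0 : ℝ) τ, ε ≤ τ - (s : ℝ) → f s = 0) ∧
      1 / 2 < ‖L f‖ ∧ ‖S.convAt τ f‖ ≤ M * ε := by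
  obtain ⟨t, ht0, htε, x, y, hxy, hx, hlt⟩ := S.exists_op_sub_of_not_isBounded hA hε
  rw [hxy.op_sub_eq_primitive] at hlt
  obtain ⟨n, hn⟩ := ((S.tendsto_weighted_bump t y).norm.eventually (lt_mem_nhds hlt)).exists
  have hsupp : ∀ r : ℝ, t ≤ r → bump t n r = 0 := fun r hr => bump_eq_zero_of_ge hr
  have hconv := S.convAt_reflectedSMul τ (bump t n) x
  refine ⟨reflectedSMul τ (bump t n) x, 1 / (n + 1), by positivity, ?_, ?_, ?_, ?_, ?_⟩
  · refine (ContinuousMap.norm_le _ zero_le_one).2 fun s => ?_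
    rw [reflectedSMul_apply, norm_smul]
    exact mul_le_one₀ (abs_bump_le _ _ _) (norm_nonneg _) hx
  · intro s hs
    rw [reflectedSMul_apply, bump_eq_zero_of_le (by simpa using hs), zero_smul]
  · intro s hs
    rw [reflectedSMul_apply, hsupp _ ((NNReal.coe_le_coe.2 htε).trans hs), zero_smul]
  · have hgen := hL (reflectedSMul τ (bump t n) x)
    rw [hconv] at hgen
    rwa [hgen.unique (hxy.weighted _ _), S.weighted_eq_of_support (htε.trans hετ) hsupp]
  · rw [hconv, S.weighted_eq_of_support (htε.trans hετ) hsupp]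
    refine (S.norm_weighted_le (fun r hr => hM r (hr.trans (htε.trans hετ)))
      (abs_bump_le _ _) x).trans ?_
    have htε' : (t : ℝ) ≤ ε := htε
    gcongr
    exact mul_le_of_le_one_right hM0 hx

end C0Semigroup

/-! ### A criterion for a sequence to be equivalent to the unit vector basis of `c₀` -/

namespace ZeroAtInftyContinuousMap

theorem norm_apply_le (f : C₀(ℕ, ℂ)) (n : ℕ) : ‖f n‖ ≤ ‖f‖ := by
  rw [← norm_toBCF_eq_norm]
  exact f.toBCF.norm_coe_le_norm n

theorem norm_le_of_forall {f : C₀(ℕ, ℂ)} {C : ℝ} (hC : 0 ≤ C) (h : ∀ n, ‖f n‖ ≤ C) : ‖f‖ ≤ C := by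
  rw [← norm_toBCF_eq_norm]
  exact (BoundedContinuousFunction.norm_le hC).2 h

/-- The coordinate functional `f ↦ f n` on `c₀`. -/
def evalCLM (n : ℕ) : C₀(ℕ, ℂ) →L[ℂ] ℂ :=
  LinearMap.mkContinuous
    { toFun := fun f => f n
      map_add' := fun _ _ => rfl
      map_smul' := fun _ _ => rfl } 1 fun f => by simpa using norm_apply_le f n

theorem evalCLM_apply (n : ℕ) (f : C₀(ℕ, ℂ)) : evalCLM n f = f n :=
  rfl

/-- The unit vector `eₙ` of `c₀`. -/
def unitVector (n : ℕ) : C₀(ℕ, ℂ) where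
  toFun := Pi.single n 1
  continuous_toFun := continuous_of_discreteTopology
  zero_at_infty' := by
    rw [cocompact_eq_cofinite]
    refine tendsto_const_nhds.congr' ?_
    filter_upwards [(Set.finite_singleton n).compl_mem_cofinite] with m hm
    rw [Pi.single_eq_of_ne hm]

theorem unitVector_apply (n m : ℕ) : unitVector n m = (Pi.single n (1 : ℂ) : ℕ → ℂ) m :=
  rfl

end ZeroAtInftyContinuousMap

open ZeroAtInftyContinuousMap

variable {X : Type*} [NormedAddCommGroup X] [NormedSpace ℂ X]

/-- An upper `c₀`-estimate for finite sums makes `∑ f n • z n` converge for `f ∈ c₀`, since the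
coefficients of late blocks are small. -/
theorem summable_smul_of_upper_estimate [CompleteSpace X] {z : ℕ → X} {C : ℝ}
    (hup : ∀ (F : Finset ℕ) (a : ℕ → ℂ) (r : ℝ), (∀ i ∈ F, ‖a i‖ ≤ r) → 0 ≤ r →
      ‖∑ i ∈ F, a i • z i‖ ≤ C * r) (f : C₀(ℕ, ℂ)) : Summable fun n => f n • z n := by
  rw [summable_iff_vanishing_norm]
  intro ε hε
  have hf : Tendsto f cofinite (𝓝 0) := by
    rw [← cocompact_eq_cofinite]
    exact f.zero_at_infty'
  have hr : 0 < ε / (|C| + 1) := by positivity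
  have hfin : {n | ¬ ‖f n‖ < ε / (|C| + 1)}.Finite :=
    (tendsto_zero_iff_norm_tendsto_zero.1 hf).eventually (gt_mem_nhds hr)
  refine ⟨hfin.toFinset, fun F hF => ?_⟩
  refine (hup F f (ε / (|C| + 1)) (fun i hi => ?_) hr.le).trans_lt ?_
  · by_contra hcon
    exact Finset.disjoint_left.1 hF hi (hfin.mem_toFinset.2 fun h => hcon h.le)
  · rw [mul_div_assoc', div_lt_iff₀ (by positivity)]
    nlinarith [le_abs_self C, abs_nonneg C]

/-- If `(z n)` has an upper `c₀`-estimate and almost biorthogonal bounded functionals `(φ m)`, then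
`(z n)` is a Schauder basis of its closed span, equivalent to the unit vector basis of `c₀`. Testing
with `φ m` gives the lower estimate: the diagonal term dominates the sum of the off-diagonal
ones. -/
theorem exists_equiv_c0_of_almost_biorthogonal [CompleteSpace X] {z : ℕ → X} {φ : ℕ → X →L[ℂ] ℂ}
    {C K : ℝ} (hup : ∀ (F : Finset ℕ) (a : ℕ → ℂ) (r : ℝ), (∀ i ∈ F, ‖a i‖ ≤ r) → 0 ≤ r →
      ‖∑ i ∈ F, a i • z i‖ ≤ C * r) (hK : 0 ≤ K) (hφ : ∀ m, ‖φ m‖ ≤ K)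
    (hdiag : ∀ m, 1 / 4 ≤ ‖φ m (z m)‖)
    (hoff : ∀ m n, m ≠ n → ‖φ m (z n)‖ ≤ 1 / 16 * (1 / 2) ^ n) :
    Nonempty ((Submodule.span ℂ (Set.range z)).topologicalClosure ≃L[ℂ] C₀(ℕ, ℂ)) ∧
      ∃ b : SchauderBasis ℂ (Submodule.span ℂ (Set.range z)).topologicalClosure,
        ∀ n : ℕ, (b n : X) = z n := by
  have hsum := summable_smul_of_upper_estimate hup
  let T : C₀(ℕ, ℂ) →L[ℂ] X := LinearMap.mkContinuous
    { toFun := fun f => ∑' n, f n • z n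
      map_add' := fun f g => by
        rw [← (hsum f).tsum_add (hsum g)]
        exact tsum_congr fun n => add_smul _ _ _
      map_smul' := fun c f => by
        rw [RingHom.id_apply, ← (hsum f).tsum_const_smul]
        exact tsum_congr fun n => mul_smul c (f n) (z n) } C fun f =>
      le_of_tendsto (hsum f).hasSum.norm (Eventually.of_forall fun F =>
        hup F f ‖f‖ (fun i _ => norm_apply_le f i) (norm_nonneg _))
  have hT : ∀ f, HasSum (fun n => f n • z n) (T f) := fun f => (hsum f).hasSum
  have hTe : ∀ n, T (unitVector n) = z n := fun n => by
    refine (hT (unitVector n)).unique ?_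
    have := hasSum_single (f := fun m => unitVector n m • z m) n fun m hm => by
      rw [unitVector_apply, Pi.single_eq_of_ne hm, zero_smul]
    rwa [unitVector_apply, Pi.single_eq_same, one_smul] at this
  have hcoord : ∀ f m, 1 / 4 * ‖f m‖ ≤ K * ‖T f‖ + 1 / 8 * ‖f‖ := by
    intro f m
    have h1 : HasSum (fun n => f n * φ m (z n)) (φ m (T f)) := by
      simpa using (φ m).hasSum (hT f)
    have h2 := h1.sub (hasSum_single (f := fun n => if n = m then f m * φ m (z m) else 0) m
      fun n hn => if_neg hn)
    simp only [if_true] at h2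
    have hgeom : HasSum (fun n : ℕ => ‖f‖ * (1 / 16 * (1 / 2 : ℝ) ^ n)) (‖f‖ * (1 / 16 * 2)) :=
      (hasSum_geometric_two.mul_left _).mul_left _
    have h3 : ‖φ m (T f) - f m * φ m (z m)‖ ≤ ‖f‖ * (1 / 16 * 2) := by
      refine h2.norm_le_of_bounded hgeom fun n => ?_
      rcases eq_or_ne n m with rfl | hnm
      · rw [if_pos rfl, sub_self, norm_zero]
        positivity
      · rw [if_neg hnm, sub_zero, norm_mul]
        exact mul_le_mul (norm_apply_le f n) (hoff m n hnm.symm) (norm_nonneg _) (norm_nonneg _)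
    have h4 : ‖φ m (T f)‖ ≤ K * ‖T f‖ := (φ m).le_of_opNorm_le (hφ m) _
    have h5 : 1 / 4 * ‖f m‖ ≤ ‖f m * φ m (z m)‖ := by
      rw [norm_mul, mul_comm]
      exact mul_le_mul_of_nonneg_left (hdiag m) (norm_nonneg _)
    have h6 := norm_sub_norm_le (f m * φ m (z m)) (φ m (T f))
    rw [norm_sub_rev] at h6
    linarith
  have hlow : ∀ f, ‖f‖ ≤ 8 * K * ‖T f‖ := by
    intro f
    have : ‖f‖ ≤ 4 * (K * ‖T f‖ + 1 / 8 * ‖f‖) :=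
      norm_le_of_forall (by positivity) fun m => by linarith [hcoord f m]
    linarith
  have hanti : AntilipschitzWith (8 * K).toNNReal T := by
    refine AddMonoidHomClass.antilipschitz_of_bound T fun f => ?_
    rw [Real.coe_toNNReal _ (by positivity)]
    exact hlow f
  have hclosed : IsClosed (Set.range T) :=
    hanti.isClosed_range T.uniformContinuous
  have hmem : ∀ n, z n ∈ (Submodule.span ℂ (Set.range z)).topologicalClosure := fun n =>
    Submodule.le_topologicalClosure _ (Submodule.subset_span ⟨n, rfl⟩)
  have hrange : T.range = (Submodule.span ℂ (Set.range z)).topologicalClosure := by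
    refine le_antisymm ?_ (Submodule.topologicalClosure_minimal _ (Submodule.span_le.2 ?_) ?_)
    · rintro _ ⟨f, rfl⟩
      exact (Submodule.isClosed_topologicalClosure _).mem_of_tendsto (hT f)
        (Eventually.of_forall fun F => Submodule.sum_mem _ fun n _ =>
          Submodule.smul_mem _ _ (hmem n))
    · rintro _ ⟨n, rfl⟩
      exact ⟨unitVector n, hTe n⟩
    · exact hclosed
  let e : C₀(ℕ, ℂ) ≃L[ℂ] (Submodule.span ℂ (Set.range z)).topologicalClosure :=
    (T.equivRange hanti.injective hclosed).trans
      (ContinuousLinearEquiv.ofEq _ _ hrange)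
  have he : ∀ f, (e f : X) = T f := fun f => rfl
  refine ⟨⟨e.symm⟩, ⟨{
    basis := fun n => ⟨z n, hmem n⟩
    coord := fun n => (evalCLM n).comp (e.symm : _ →L[ℂ] C₀(ℕ, ℂ))
    ortho := fun i j => ?_
    expansion := fun x => ?_ }, fun n => rfl⟩⟩
  · have : e.symm ⟨z j, hmem j⟩ = unitVector j := by
      rw [ContinuousLinearEquiv.symm_apply_eq]
      exact Subtype.ext ((hTe j).symm.trans (he _).symm)
    rw [ContinuousLinearMap.comp_apply, ContinuousLinearEquiv.coe_coe, this, evalCLM_apply,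
      unitVector_apply]
    congr!
  · have hx : HasSum (fun n => e.symm x n • z n) (x : X) := by
      have := hT (e.symm x)
      rwa [← he, ContinuousLinearEquiv.apply_symm_apply] at this
    have hx' : HasSum (fun n => e.symm x n •
        (⟨z n, hmem n⟩ : (Submodule.span ℂ (Set.range z)).topologicalClosure)) x := by
      have hind : IsInducing (Submodule.span ℂ (Set.range z)).topologicalClosure.subtype :=
        IsInducing.subtypeVal
      exact (hind.hasSum_iff _ _).1 hx
    exact hx'.mono_left (SummationFilter.LeAtTop.le_atTop)

/-! ### Selecting the sequence -/

/-- At each point at most one of the functions is nonzero, so `∑ aᵢ fᵢ` has sup norm at most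
`max ‖aᵢ‖`. -/
theorem norm_sum_smul_le_of_disjoint {α E : Type*} [TopologicalSpace α] [CompactSpace α]
    [NormedAddCommGroup E] [NormedSpace ℂ E] {f : ℕ → C(α, E)} (hf : ∀ n, ‖f n‖ ≤ 1)
    (hdisj : ∀ m n, m ≠ n → ∀ s, f m s = 0 ∨ f n s = 0) (F : Finset ℕ) (a : ℕ → ℂ) (r : ℝ)
    (ha : ∀ i ∈ F, ‖a i‖ ≤ r) (hr : 0 ≤ r) : ‖∑ i ∈ F, a i • f i‖ ≤ r := by
  refine (ContinuousMap.norm_le _ hr).2 fun s => ?_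
  rw [ContinuousMap.sum_apply]
  by_cases h : ∃ m ∈ F, f m s ≠ 0
  · obtain ⟨m, hm, hms⟩ := h
    rw [Finset.sum_eq_single_of_mem m hm fun n _ hnm => ?_]
    · rw [ContinuousMap.smul_apply, norm_smul]
      exact (mul_le_of_le_one_right (norm_nonneg _) (((f m).norm_coe_le_norm s).trans (hf m))).trans
        (ha m hm)
    · rw [ContinuousMap.smul_apply, ((hdisj m n hnm.symm s).resolve_left hms), smul_zero]
  · push Not at h
    rw [Finset.sum_eq_zero fun n hn => by rw [ContinuousMap.smul_apply, h n hn, smul_zero],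
      norm_zero]
    exact hr

namespace C0Semigroup

variable {X : Type*} [NormedAddCommGroup X] [NormedSpace ℂ X]

/-- The average `x ↦ h⁻¹ ∫₀ʰ S(r)x dr`. -/
def average [CompleteSpace X] (S : C0Semigroup X) (h : ℝ≥0) : X →L[ℂ] X :=
  (((h : ℝ)⁻¹ : ℝ) : ℂ) • S.primitive h

theorem average_apply [CompleteSpace X] (S : C0Semigroup X) (h : ℝ≥0) (x : X) :
    S.average h x = ((h : ℝ)⁻¹ : ℝ) • S.primitive h x := by
  rw [average, _root_.smul_apply, Complex.coe_smul]

theorem norm_average_le [CompleteSpace X] (S : C0Semigroup X) {h : ℝ≥0} (hh : 0 < h) {M : ℝ}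
    (hM0 : 0 ≤ M) (hM : ∀ t ≤ h, ‖S.op t‖ ≤ M) : ‖S.average h‖ ≤ M := by
  refine ContinuousLinearMap.opNorm_le_bound _ hM0 fun x => ?_
  have hh' : (0 : ℝ) < h := hh
  rw [average_apply, norm_smul, Real.norm_of_nonneg (by positivity), inv_mul_le_iff₀ hh']
  exact (S.norm_primitive_le hM x).trans_eq (by ring)

theorem tendsto_average [CompleteSpace X] (S : C0Semigroup X) (x : X) :
    Tendsto (fun h => S.average h x) (𝓝[>] 0) (𝓝 x) := by
  simpa only [average_apply] using S.tendsto_inv_smul_primitive x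

/-- `Tₕ A` is a bounded operator, where `Tₕ` is the average over `[0,h]`. -/
theorem HasGeneratorValue.norm_average_le [CompleteSpace X] {S : C0Semigroup X} {h : ℝ≥0} {w y : X}
    (hwy : S.HasGeneratorValue w y) : ‖S.average h y‖ ≤ (h : ℝ)⁻¹ * (‖S.op h‖ + 1) * ‖w‖ := by
  rw [average_apply, ← hwy.op_sub_eq_primitive, norm_smul, Real.norm_of_nonneg (by positivity),
    mul_assoc]
  gcongr
  refine (norm_sub_le _ _).trans ?_
  linarith [(S.op h).le_opNorm w]

theorem op_average [CompleteSpace X] (S : C0Semigroup X) (t h : ℝ≥0) (x : X) :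
    S.op t (S.average h x) = S.average h (S.op t x) := by
  rw [average_apply, average_apply, ContinuousLinearMap.map_smul_of_tower, primitive, op_weighted]

/-- The data carried along the selection of the basic sequence. -/
structure SelectionState (τ : ℝ≥0) (X : Type*) [NormedAddCommGroup X] [NormedSpace ℂ X] where
  /-- The index, which governs the smallness of off-diagonal terms. -/
  j : ℕ
  /-- A function, concentrated near `τ` but vanishing in a neighbourhood of `τ`. -/
  f : C(Icc (0 : ℝ) τ, X)
  /-- The length of an interval ending in `τ` on which `f` vanishes. -/
  a : ℝ≥0
  /-- A functional that detects `A(S * f)(τ)`. -/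
  φ : X →L[ℂ] ℂ
  /-- A bound for the functional `φ ∘ A`. -/
  B : ℝ

/-- The requirements on a single member of the selection; here `L f = A(S * f)(τ)` and `M` is a
bound for `S` on `[0,τ]`. -/
structure SelectionState.IsAdmissible [CompleteSpace X] {τ : ℝ≥0} (p : SelectionState τ X)
    (S : C0Semigroup X) (L : C(Icc (0 : ℝ) τ, X) →L[ℂ] X) (M : ℝ) : Prop where
  a_pos : 0 < p.a
  norm_f_le : ‖p.f‖ ≤ 1
  f_eq_zero : ∀ s : Icc (0 : ℝ) τ, τ - (s : ℝ) ≤ p.a → p.f s = 0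
  lt_norm : 1 / 2 < ‖L p.f‖
  norm_convAt_le : ‖S.convAt τ p.f‖ ≤ (1 / 2) ^ p.j
  norm_φ_le : ‖p.φ‖ ≤ M * (1 + M)
  le_norm_φ : 1 / 4 ≤ ‖p.φ (L p.f)‖
  norm_φ_generator_le : ∀ w y, S.HasGeneratorValue w y → ‖p.φ y‖ ≤ p.B * ‖w‖

/-- The functional has the form `ψ ∘ Tₗ ∘ (1 - Tₖ)` with averages `Tₗ, Tₖ` of the semigroup. The
factor `1 - Tₖ` makes it small at finitely many given vectors. Since `Tₖ A` and `Tₗ A` are bounded,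
`Tₖ y` is small for `y = A w` with `w` small, so not much of `y` is lost, and the composition of the
functional with `A` is bounded. -/
theorem exists_functional [CompleteSpace X] {S : C0Semigroup X} {τ : ℝ≥0} (hτ : 0 < τ) {M : ℝ}
    (hM0 : 0 < M) (hM : ∀ t ≤ τ, ‖S.op t‖ ≤ M) {k : ℝ≥0} (hk0 : 0 < k) (hkτ : k ≤ τ) {y : X}
    (hy : 1 / 2 < ‖y‖) (hky : ‖S.average k y‖ ≤ 1 / 8) :
    ∃ (φ : X →L[ℂ] ℂ) (B : ℝ), ‖φ‖ ≤ M * (1 + M) ∧ 1 / 4 ≤ ‖φ y‖ ∧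
      (∀ v, ‖φ v‖ ≤ M * ‖v - S.average k v‖) ∧
      ∀ w v, S.HasGeneratorValue w v → ‖φ v‖ ≤ B * ‖w‖ := by
  set W : X →L[ℂ] X := ContinuousLinearMap.id ℂ X - S.average k with hW
  have hWapply : ∀ v, W v = v - S.average k v := fun v => rfl
  have hWy : 1 / 4 < ‖W y‖ := by
    have := norm_sub_norm_le y (S.average k y)
    rw [hWapply]
    linarith
  have hWnorm : ‖W‖ ≤ 1 + M :=
    (norm_sub_le _ _).trans (add_le_add ContinuousLinearMap.norm_id_le
      (S.norm_average_le hk0 hM0.le fun t ht => hM t (ht.trans hkτ)))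
  obtain ⟨l, hly, hl0, hlτ⟩ := (((S.tendsto_average (W y)).norm.eventually
    (lt_mem_nhds hWy)).and (Ioc_mem_nhdsGT hτ)).exists
  have hlM : ‖S.average l‖ ≤ M :=
    S.norm_average_le hl0 hM0.le fun t ht => hM t (ht.trans hlτ)
  obtain ⟨ψ, hψ1, hψ⟩ := exists_dual_vector'' ℂ (S.average l (W y))
  have hψle : ∀ v, ‖ψ v‖ ≤ ‖v‖ := fun v => by simpa using ψ.le_of_opNorm_le hψ1 v
  have hφW : ∀ v, ‖ψ (S.average l (W v))‖ ≤ M * ‖W v‖ := fun v =>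
    (hψle _).trans ((S.average l).le_of_opNorm_le hlM _)
  refine ⟨ψ.comp ((S.average l).comp W), (l : ℝ)⁻¹ * (‖S.op l‖ + 1) * (1 + M), ?_, ?_, ?_, ?_⟩
  · refine ContinuousLinearMap.opNorm_le_bound _ (by positivity) fun v => ?_
    refine (hφW v).trans ?_
    rw [mul_assoc]
    exact mul_le_mul_of_nonneg_left (W.le_of_opNorm_le hWnorm v) hM0.le
  · rw [ContinuousLinearMap.comp_apply, ContinuousLinearMap.comp_apply, hψ]
    simpa using hly.le
  · exact hφW
  · intro w v hwv
    have hgen : S.HasGeneratorValue (W w) (W v) :=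
      hwv.map W fun t x => by rw [hWapply, hWapply, map_sub, S.op_average]
    refine (hψle _).trans (hgen.norm_average_le.trans ?_)
    rw [mul_assoc _ (1 + M)]
    exact mul_le_mul_of_nonneg_left (W.le_of_opNorm_le hWnorm w) (by positivity)

/-- Finitely many admissible states can be continued by one whose function has disjoint support
from theirs and whose off-diagonal pairings with theirs are small. In both directions the bound
carries the index of the vector, not of the functional, so that the pairings of one functional with
all other vectors form a summable sequence. -/
theorem exists_selection_step [CompleteSpace X] {S : C0Semigroup X}
    (hA : ¬ UnboundedOperator.IsBounded S.generator) {τ : ℝ≥0} (hτ : 0 < τ)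
    {L : C(Icc (0 : ℝ) τ, X) →L[ℂ] X} (hL : ∀ f, S.HasGeneratorValue (S.convAt τ f) (L f))
    {M : ℝ} (hM0 : 0 < M) (hM : ∀ t ≤ τ, ‖S.op t‖ ≤ M)
    (s : Finset (SelectionState τ X)) (hs : ∀ p ∈ s, p.IsAdmissible S L M) :
    ∃ q : SelectionState τ X, q.IsAdmissible S L M ∧ ∀ p ∈ s, p.j < q.j ∧
      (∀ r, p.f r = 0 ∨ q.f r = 0) ∧
      ‖p.φ (L q.f)‖ ≤ 1 / 16 * (1 / 2) ^ q.j ∧ ‖q.φ (L p.f)‖ ≤ 1 / 16 * (1 / 2) ^ p.j := by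
  obtain ⟨j, hj⟩ : ∃ j : ℕ, ∀ p ∈ s, p.j < j :=
    ⟨s.sup SelectionState.j + 1, fun p hp => Nat.lt_succ_of_le (Finset.le_sup hp)⟩
  have hk : ∀ᶠ k : ℝ≥0 in 𝓝[>] 0, ∀ p ∈ s,
      ‖L p.f - S.average k (L p.f)‖ < M⁻¹ * (1 / 16 * (1 / 2) ^ p.j) := by
    rw [eventually_all_finset]
    intro p _
    have := (tendsto_const_nhds (x := L p.f)).sub (S.tendsto_average (L p.f))
    rw [sub_self] at this
    exact (tendsto_zero_iff_norm_tendsto_zero.1 this).eventually (gt_mem_nhds (by positivity))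
  obtain ⟨k, hks, hk0, hkτ⟩ := (hk.and (Ioc_mem_nhdsGT hτ)).exists
  -- The new function is supported in `[τ - ε, τ]`; all remaining requirements hold for small `ε`,
  -- because `‖(S * f)(τ)‖ ≤ M ε`.
  have hlin : ∀ c b : ℝ, 0 < b → ∀ᶠ ε : ℝ≥0 in 𝓝[>] 0, c * (M * (ε : ℝ)) < b := by
    intro c b hb
    have : Continuous fun ε : ℝ≥0 => c * (M * (ε : ℝ)) := by fun_prop
    exact ((this.tendsto' 0 0 (by simp)).mono_left nhdsWithin_le_nhds).eventually (gt_mem_nhds hb)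
  have hεs : ∀ᶠ ε : ℝ≥0 in 𝓝[>] 0, ∀ p ∈ s,
      ε ≤ p.a ∧ |p.B| * (M * (ε : ℝ)) < 1 / 16 * (1 / 2) ^ j := by
    rw [eventually_all_finset]
    intro p hp
    filter_upwards [Ioc_mem_nhdsGT (hs p hp).a_pos,
      hlin |p.B| (1 / 16 * (1 / 2) ^ j) (by positivity)] with ε h1 h2 using ⟨h1.2, h2⟩
  obtain ⟨ε, hεs, hεj, hεk, hε0, hετ⟩ := (hεs.and ((hlin 1 ((1 / 2) ^ j) (by positivity)).and
    ((hlin ((k : ℝ)⁻¹ * (‖S.op k‖ + 1)) (1 / 8) (by norm_num)).and (Ioc_mem_nhdsGT hτ)))).exists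
  obtain ⟨f, a, ha, hf1, hfa, hfε, hLf, hw⟩ := exists_concentrated hA hL hM0.le hM hε0 hετ
  have hky : ‖S.average k (L f)‖ ≤ 1 / 8 :=
    (hL f).norm_average_le.trans ((mul_le_mul_of_nonneg_left hw (by positivity)).trans hεk.le)
  obtain ⟨φ, B, hφ, hφy, hφk, hφB⟩ := exists_functional hτ hM0 hM hk0 hkτ hLf hky
  refine ⟨⟨j, f, a, φ, B⟩, ⟨ha, hf1, hfa, hLf, ?_, hφ, hφy, hφB⟩, fun p hp =>
    ⟨hj p hp, fun r => ?_, ?_, ?_⟩⟩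
  · rw [one_mul] at hεj
    exact hw.trans hεj.le
  · rcases le_total ((τ : ℝ) - r) p.a with h | h
    · exact Or.inl ((hs p hp).f_eq_zero r h)
    · exact Or.inr (hfε r ((NNReal.coe_le_coe.2 (hεs p hp).1).trans h))
  · calc ‖p.φ (L f)‖ ≤ p.B * ‖S.convAt τ f‖ := (hs p hp).norm_φ_generator_le _ _ (hL f)
      _ ≤ |p.B| * (M * ε) :=
        mul_le_mul (le_abs_self _) hw (norm_nonneg _) (abs_nonneg _)
      _ ≤ 1 / 16 * (1 / 2) ^ j := (hεs p hp).2.le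
  · refine (hφk _).trans ?_
    have := (hks p hp).le
    rwa [inv_mul_eq_div, le_div_iff₀' hM0] at this

/-- On `D(A)` the resolvent satisfies `R A w = μ R w - w`, so it maps `A w` to a small vector when
`w` is small. -/
theorem tendsto_resolvent_of_hasGeneratorValue {S : C0Semigroup X} {w y : ℕ → X}
    (hwy : ∀ n, S.HasGeneratorValue (w n) (y n)) (hw : Tendsto w atTop (𝓝 0)) {μ : ℂ}
    (hμ : μ ∈ UnboundedOperator.resolventSet S.generator) :
    Tendsto (fun n => UnboundedOperator.resolvent S.generator μ (y n)) atTop (𝓝 0) := by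
  set R := UnboundedOperator.resolvent S.generator μ
  have hR : ∀ n, R (y n) = μ • R (w n) - w n := by
    intro n
    let x : S.generator.domain := ⟨w n, y n, hwy n⟩
    have h1 : R (μ • w n - S.generator x) = w n :=
      (UnboundedOperator.isResolventAt_resolvent hμ).2 x
    have h2 : S.generator x = y n := (S.generator_spec x).unique (hwy n)
    rw [h2, map_sub, map_smul] at h1
    rw [sub_eq_iff_eq_add] at h1
    rw [h1, add_sub_cancel_left]
  have hcont : Continuous fun v => μ • R v - v := by fun_prop
  refine ((hcont.tendsto' 0 0 (by simp)).comp hw).congr fun n => (hR n).symm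

end C0Semigroup

end

theorem proposition2p5 {X : Type*} [NormedAddCommGroup X] [NormedSpace ℂ X] [CompleteSpace X]
    (S : C0Semigroup X) (hS : S.HasCMaximalRegularity)
    (hA : ¬ UnboundedOperator.IsBounded S.generator) :
    ∃ z : ℕ → X,
      Nonempty ((Submodule.span ℂ (Set.range z)).topologicalClosure ≃L[ℂ] C₀(ℕ, ℂ)) ∧
      (∃ b : SchauderBasis ℂ (Submodule.span ℂ (Set.range z)).topologicalClosure,
        ∀ n : ℕ, (b n : X) = z n) ∧
      (0 < ⨅ n : ℕ, ‖z n‖) ∧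
      BddAbove (Set.range fun n : ℕ => ‖z n‖) ∧
      ∀ μ ∈ UnboundedOperator.resolventSet S.generator,
        Tendsto (fun n : ℕ => UnboundedOperator.resolvent S.generator μ (z n)) atTop (𝓝 0) := by
  obtain ⟨τ, hτ, L, hL⟩ := hS.exists_generator_convAt
  obtain ⟨M, hM0, hM⟩ := S.exists_norm_op_le τ
  obtain ⟨p, hp, hpp⟩ := exists_seq_of_forall_finset_exists _ _
    (C0Semigroup.exists_selection_step hA hτ hL hM0 hM)
  have hmono : StrictMono fun n => (p n).j := fun m n hmn => (hpp m n hmn).1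
  have hpow : ∀ n, (1 / 2 : ℝ) ^ (p n).j ≤ (1 / 2) ^ n := fun n =>
    pow_le_pow_of_le_one (by norm_num) (by norm_num) (hmono.id_le n)
  have hdisj : ∀ m n, m ≠ n → ∀ s, (p m).f s = 0 ∨ (p n).f s = 0 := by
    intro m n hmn s
    rcases hmn.lt_or_gt with h | h
    · exact (hpp m n h).2.1 s
    · exact ((hpp n m h).2.1 s).symm
  have hoff : ∀ m n, m ≠ n → ‖(p m).φ (L (p n).f)‖ ≤ 1 / 16 * (1 / 2) ^ n := by
    intro m n hmn
    refine le_trans ?_ (mul_le_mul_of_nonneg_left (hpow n) (by norm_num))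
    rcases hmn.lt_or_gt with h | h
    · exact (hpp m n h).2.2.1
    · exact (hpp n m h).2.2.2
  have hup : ∀ (F : Finset ℕ) (a : ℕ → ℂ) (r : ℝ), (∀ i ∈ F, ‖a i‖ ≤ r) → 0 ≤ r →
      ‖∑ i ∈ F, a i • L (p i).f‖ ≤ ‖L‖ * r := by
    intro F a r ha hr
    have := L.le_of_opNorm_le_of_le le_rfl
      (norm_sum_smul_le_of_disjoint (fun n => (hp n).norm_f_le) hdisj F a r ha hr)
    simpa using this
  obtain ⟨hiso, hbasis⟩ := exists_equiv_c0_of_almost_biorthogonal hup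
    (by positivity : 0 ≤ M * (1 + M)) (fun m => (hp m).norm_φ_le) (fun m => (hp m).le_norm_φ) hoff
  refine ⟨fun n => L (p n).f, hiso, hbasis, ?_, ?_, fun μ hμ => ?_⟩
  · exact lt_of_lt_of_le (by norm_num) (le_ciInf fun n => (hp n).lt_norm.le)
  · refine ⟨‖L‖ * 1, ?_⟩
    rintro _ ⟨n, rfl⟩
    exact L.le_of_opNorm_le_of_le le_rfl (hp n).norm_f_le
  · refine C0Semigroup.tendsto_resolvent_of_hasGeneratorValue (fun n => hL (p n).f) ?_ hμ
    exact squeeze_zero_norm (fun n => (hp n).norm_convAt_le.trans (hpow n))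
      (tendsto_pow_atTop_nhds_zero_of_lt_one (by norm_num) (by norm_num))
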